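/- **Conventions.** Let $\mathcal Z=\{\dots,\tfrac13,\tfrac12,1,2,3,\dots\}$ and let $\mathcal N$ be the set of non-decreasing functions $\mathcal Z\to[0,\infty]$. For a real $t>0$ let $t_-$ and $t_+$ be the largest, respectively smallest, element of $\mathcal Z$ with $t_-\le t\le t_+$. Let $\mathcal M_{\rm coarse}$ be the set of all $(\kappa,\omega)\in\mathcal N\times\mathcal N$ with $\omega(r)<\infty$ for all $r\in\mathcal Z$ and $\lim_{n\to\infty}\kappa(n)=\infty$. A map $\phi\colon X\to E$ between metric spaces is a *coarse embedding* if $(\kappa_\phi,\omega_\phi)\in\mathcal M_{\rm coarse}$, where for $r\in\mathcal Z$ $$\kappa_\phi(r)=\inf\{d_E(\phi(x),\phi(y)) : d_X(x,y)\ge r\},\qquad \omega_\phi(r)=\sup\{d_E(\phi(x),\phi(y)) : d_X(x,y)\le r\}.$$ Let $(e_n)$ be a Schauder basis of a real Banach space $X$. It is called *subsymmetric* if it is equivalent to each of its infinite subsequences, i.e. if for all $n_1<n_2<\cdots$ there is $C>0$ such that $C^{-1}\|\sum_k a_ke_k\|\le\|\sum_k a_ke_{n_k}\|\le C\|\sum_k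 a_ke_k\|$ for all finitely supported real sequences $(a_k)$. (Unconditionality is not required.) Let $\mathbb Q[e_1,e_2,\dots]\subseteq X$ be the set of finite rational linear combinations of the $e_n$, with the metric given by the norm of $X$; for a set $A$ of basis vectors let $\mathbb Q[A]$ be its $\mathbb Q$-linear span. For a metric space $E$, let $\mathcal Coa(\mathbb Q,(e_n),E)$ be the set of all quadruples $(\kappa,\omega,A,\phi)$ where $(\kappa,\omega)\in\mathcal M_{\rm coarse}$, $A$ is a finite subset of $\{e_1,e_2,\dots\}$ and $\phi\colon\mathbb Q[e_1,e_2,\dots]\to E$ is a function with $$\kappa(\|x-y\|_-)\le d_E(\phi(x),\phi(y))\le\omega(\|x-y\|_+)\qquad\text{for all distinct }x,y\in\mathbb Q[A].$$ Put $(\kappa,\omega,A,\phi)<(\kappa',\omega',A',\phi')$ if $(\kappa,\omega)=(\kappa',\omega')$, $A=A'\cup\{e_m\}$ for some $m$ larger than the indices of all elements of $A'$, and $\phi,\phi'$ agree on $\mathbb Q[A']$. The rank of a well-founded relation $\prec$ on a set $S$ is the ordinal ${\sf rk}(S,\prec)=\sup\{\rho(x)+1 : x\in S\}$, where $\rho(x)=\sup\{\rho(y)+1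 : y\prec x\}$. **Corollary.** Let $(e_n)_{n=1}^\infty$ be a subsymmetric Schauder basis of a real Banach space $X$ and let $E$ be a separable complete metric space. Then either $X$ coarsely embeds into $E$, or the relation $<$ on $\mathcal Coa(\mathbb Q,(e_n),E)$ is well-founded and its rank ${\sf rk}\big(\mathcal Coa(\mathbb Q,(e_n),E),<\big)$ is a countable ordinal. -/

import Mathlib

open Filter Topology
open scoped ENNReal

noncomputable section

namespace EmbRank

/-! ### Functional moduli and coarse embeddings -/

/-- The set `{…, 1/3, 1/2, 1, 2, 3, …}` of positive integers and their reciprocals. -/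
def scaleSet : Set ℝ := {r | ∃ n : ℕ, 0 < n ∧ (r = n ∨ r = 1 / (n : ℝ))}

/-- `scaleSet` as a linearly ordered type, with the order of the reals. -/
abbrev Scale : Type := scaleSet

/-- The positive integer `n + 1` as a scale. -/
def Scale.ofNatSucc (n : ℕ) : Scale :=
  ⟨((n + 1 : ℕ) : ℝ), n + 1, n.succ_pos, Or.inl rfl⟩

/-- The non-decreasing functions from the scales to `[0, ∞]`. -/
abbrev Modulus : Type := Scale →o ℝ≥0∞

theorem exists_isGreatest_scale {t : ℝ} (ht : 0 < t) :
    ∃ a : Scale, IsGreatest {z : Scale | (z : ℝ) ≤ t} a := by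
  rcases le_or_gt 1 t with h | h
  · have h1 : 0 < ⌊t⌋₊ := Nat.floor_pos.2 h
    have h1' : (1 : ℝ) ≤ (⌊t⌋₊ : ℝ) := by exact_mod_cast h1
    refine ⟨⟨(⌊t⌋₊ : ℝ), ⌊t⌋₊, h1, Or.inl rfl⟩, Nat.floor_le ht.le, ?_⟩
    rintro ⟨z, n, hn, rfl | rfl⟩ hz
    · exact Subtype.mk_le_mk.2 (Nat.cast_le.2 (Nat.le_floor hz))
    · refine Subtype.mk_le_mk.2 (le_trans ?_ h1')
      rw [div_le_one (by exact_mod_cast hn)]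
      exact_mod_cast hn
  · have hi : 0 < 1 / t := by positivity
    have h1 : 0 < ⌈1 / t⌉₊ := Nat.ceil_pos.2 hi
    refine ⟨⟨1 / (⌈1 / t⌉₊ : ℝ), ⌈1 / t⌉₊, h1, Or.inr rfl⟩, ?_, ?_⟩
    · exact (one_div_le (by exact_mod_cast h1) ht).2 (Nat.le_ceil _)
    · rintro ⟨z, n, hn, rfl | rfl⟩ hz
      · have : (1 : ℝ) ≤ n := by exact_mod_cast hn
        exact absurd (lt_of_le_of_lt (show (n : ℝ) ≤ t from hz) h) (not_lt.2 this)
      · have hn' : (0 : ℝ) < n := by exact_mod_cast hn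
        refine Subtype.mk_le_mk.2 (one_div_le_one_div_of_le (by exact_mod_cast h1) ?_)
        exact Nat.cast_le.2 (Nat.ceil_le.2 ((one_div_le ht hn').2 hz))

theorem exists_isLeast_scale {t : ℝ} (ht : 0 < t) :
    ∃ a : Scale, IsLeast {z : Scale | t ≤ (z : ℝ)} a := by
  rcases lt_or_ge 1 t with h | h
  · have h1 : 0 < ⌈t⌉₊ := Nat.ceil_pos.2 ht
    refine ⟨⟨(⌈t⌉₊ : ℝ), ⌈t⌉₊, h1, Or.inl rfl⟩, Nat.le_ceil t, ?_⟩
    rintro ⟨z, n, hn, rfl | rfl⟩ hz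
    · exact Subtype.mk_le_mk.2 (Nat.cast_le.2 (Nat.ceil_le.2 hz))
    · have hn' : (0 : ℝ) < n := by exact_mod_cast hn
      have : 1 / (n : ℝ) ≤ 1 := by
        rw [div_le_one hn']
        exact_mod_cast hn
      exact absurd (lt_of_lt_of_le h (show t ≤ 1 / (n : ℝ) from hz)) (not_lt.2 this)
  · have h1i : 1 ≤ 1 / t := by rwa [le_div_iff₀ ht, one_mul]
    have h1 : 0 < ⌊1 / t⌋₊ := Nat.floor_pos.2 h1i
    have h1' : (1 : ℝ) ≤ (⌊1 / t⌋₊ : ℝ) := by exact_mod_cast h1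
    refine ⟨⟨1 / (⌊1 / t⌋₊ : ℝ), ⌊1 / t⌋₊, h1, Or.inr rfl⟩, ?_, ?_⟩
    · exact (le_one_div ht (by exact_mod_cast h1)).2 (Nat.floor_le (by positivity))
    · rintro ⟨z, n, hn, rfl | rfl⟩ hz
      · refine Subtype.mk_le_mk.2 (le_trans (b := 1) ?_ (by exact_mod_cast hn))
        rwa [div_le_one (by linarith)]
      · have hn' : (0 : ℝ) < n := by exact_mod_cast hn
        refine Subtype.mk_le_mk.2 (one_div_le_one_div_of_le hn' ?_)
        exact Nat.cast_le.2 (Nat.le_floor ((le_one_div ht hn').1 hz))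

/-- `t₋`, the largest scale below `t`, for `t > 0`. -/
def lowerScale (t : ℝ) (ht : 0 < t) : Scale := (exists_isGreatest_scale ht).choose

/-- `t₊`, the smallest scale above `t`, for `t > 0`. -/
def upperScale (t : ℝ) (ht : 0 < t) : Scale := (exists_isLeast_scale ht).choose

theorem isGreatest_lowerScale {t : ℝ} (ht : 0 < t) :
    IsGreatest {z : Scale | (z : ℝ) ≤ t} (lowerScale t ht) :=
  (exists_isGreatest_scale ht).choose_spec

theorem isLeast_upperScale {t : ℝ} (ht : 0 < t) :
    IsLeast {z : Scale | t ≤ (z : ℝ)} (upperScale t ht) :=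
  (exists_isLeast_scale ht).choose_spec

/-- The compression modulus `κ_φ(r) = inf {d(φ x, φ y) | d(x, y) ≥ r}` (with `inf ∅ = ∞`). -/
def compression {X E : Type*} [MetricSpace X] [MetricSpace E] (φ : X → E) : Modulus where
  toFun r := ⨅ (x : X) (y : X) (_ : (r : ℝ) ≤ dist x y), edist (φ x) (φ y)
  monotone' _ _ hrs := iInf_mono fun _ => iInf_mono fun _ =>
    iInf_mono' fun h => ⟨le_trans (Subtype.coe_le_coe.2 hrs) h, le_rfl⟩

/-- The expansion modulus `ω_φ(r) = sup {d(φ x, φ y) | d(x, y) ≤ r}`. -/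
def expansion {X E : Type*} [MetricSpace X] [MetricSpace E] (φ : X → E) : Modulus where
  toFun r := ⨆ (x : X) (y : X) (_ : dist x y ≤ (r : ℝ)), edist (φ x) (φ y)
  monotone' _ _ hrs := iSup_mono fun _ => iSup_mono fun _ =>
    iSup_mono' fun h => ⟨le_trans h (Subtype.coe_le_coe.2 hrs), le_rfl⟩

/-- The class of pairs `(κ, ω)` of moduli with `ω(r) < ∞` for all `r` and
`κ(n) → ∞` as the integer `n` tends to infinity. -/
def IsCoarsePair (κ ω : Modulus) : Prop :=
  (∀ r : Scale, ω r < ∞) ∧ Tendsto (fun n : ℕ => κ (Scale.ofNatSucc n)) atTop (𝓝 ∞)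

/-- `φ` is a coarse embedding. -/
def IsCoarseEmbedding {X E : Type*} [MetricSpace X] [MetricSpace E] (φ : X → E) : Prop :=
  IsCoarsePair (compression φ) (expansion φ)

/-- `X` coarsely embeds into `E`. -/
def CoarselyEmbeds (X E : Type*) [MetricSpace X] [MetricSpace E] : Prop :=
  ∃ φ : X → E, IsCoarseEmbedding φ

/-! ### Rank of a well-founded relation -/

/-- The rank `sup {ρ(x) + 1 | x ∈ A}` of a well-founded relation on `A`, where `ρ` is its rank
function `ρ(x) = sup {ρ(y) + 1 | y ≺ x}`. -/
def relRank.{u} {A : Type u} (r : A → A → Prop) (h : WellFounded r) : Ordinal.{u} :=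
  ⨆ x : A, Order.succ (h.apply x).rank

/-- The relation `r` is well-founded and its rank is a countable ordinal. -/
def HasCountableRank.{u} {A : Type u} (r : A → A → Prop) : Prop :=
  ∃ h : WellFounded r, relRank r h < Ordinal.omega.{u} 1

/-! ### Subsymmetric sequences -/

/-- Two sequences of vectors are equivalent: for some `C > 0` the norms of corresponding finite
linear combinations are within a factor `C` of each other. -/
def EquivalentSeq {X : Type*} [NormedAddCommGroup X] [NormedSpace ℝ X] (x y : ℕ → X) : Prop :=
  ∃ C : ℝ, 0 < C ∧ ∀ a : ℕ →₀ ℝ,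
    ‖Finsupp.linearCombination ℝ x a‖ ≤ C * ‖Finsupp.linearCombination ℝ y a‖ ∧
    ‖Finsupp.linearCombination ℝ y a‖ ≤ C * ‖Finsupp.linearCombination ℝ x a‖

/-- A sequence is subsymmetric if it is equivalent to each of its infinite subsequences.
(Authors who also demand unconditionality define a subclass of these sequences.) -/
def IsSubsymmetric {X : Type*} [NormedAddCommGroup X] [NormedSpace ℝ X] (e : ℕ → X) : Prop :=
  ∀ n : ℕ → ℕ, StrictMono n → EquivalentSeq e (e ∘ n)

/-! ### The rank of coarse embeddability over the rationals

The free `ℚ`-module `ℚ[e₀, e₁, …]` is `ℕ →₀ ℚ`, finite sets of basis vectors are given by their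
finite sets `A` of indices, and `ℚ[A]` is `Finsupp.supported ℚ ℚ A`. -/

/-- The vector `∑ xₙ eₙ` of `X` given by an element of `ℚ[e₀, e₁, …]`. -/
def realize {X : Type*} [NormedAddCommGroup X] [NormedSpace ℝ X] (e : ℕ → X) (x : ℕ →₀ ℚ) : X :=
  x.sum fun n q => (q : ℝ) • e n

/-- `A ≺⋆ B`: the set `A` arises from `B` by adding one element above all elements of `B`. -/
def StarPrec (A B : Finset ℕ) : Prop :=
  ∃ m : ℕ, (∀ n ∈ B, n < m) ∧ A = insert m B

/-- The quadruples `(κ, ω, A, φ)` of two moduli, a finite set `A` of (indices of) basis vectors and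
a map `φ : ℚ[e₀, e₁, …] → E`. -/
abbrev Quad (E : Type*) : Type _ := Modulus × Modulus × Finset ℕ × ((ℕ →₀ ℚ) → E)

/-- `Θ(ℚ, (eₙ), E)`: the quadruples with
`κ(‖x - y‖₋) ≤ d(φ x, φ y) ≤ ω(‖x - y‖₊)` for all `x, y ∈ ℚ[A]` that are distinct in `X`. -/
def Theta {X : Type*} [NormedAddCommGroup X] [NormedSpace ℝ X] (e : ℕ → X)
    (E : Type*) [MetricSpace E] : Set (Quad E) :=
  {q | match q with
    | (κ, ω, A, φ) =>
      ∀ x ∈ Finsupp.supported ℚ ℚ (A : Set ℕ), ∀ y ∈ Finsupp.supported ℚ ℚ (A : Set ℕ),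
        ∀ h : 0 < ‖realize e x - realize e y‖,
          κ (lowerScale _ h) ≤ edist (φ x) (φ y) ∧ edist (φ x) (φ y) ≤ ω (upperScale _ h)}

/-- `Coa(ℚ, (eₙ), E)`: the elements `(κ, ω, A, φ)` of `Θ(ℚ, (eₙ), E)` for which `(κ, ω)` is a
coarse pair. -/
def Coa {X : Type*} [NormedAddCommGroup X] [NormedSpace ℝ X] (e : ℕ → X)
    (E : Type*) [MetricSpace E] : Set (Quad E) :=
  {q | q ∈ Theta e E ∧ IsCoarsePair q.1 q.2.1}

/-- The relation `(κ, ω, A, φ) < (κ', ω', A', φ')`: the moduli agree, `A ≺⋆ A'`, and `φ`, `φ'`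
agree on `ℚ[A']`. -/
def QuadLT {E : Type*} : Quad E → Quad E → Prop
  | (κ, ω, A, φ), (κ', ω', A', φ') =>
    (κ = κ' ∧ ω = ω') ∧ StarPrec A A' ∧
      Set.EqOn φ φ' (Finsupp.supported ℚ ℚ (A' : Set ℕ) : Set (ℕ →₀ ℚ))

/-- The relation `<` restricted to `Coa(ℚ, (eₙ), E)`. -/
def CoaLT {X : Type*} [NormedAddCommGroup X] [NormedSpace ℝ X] (e : ℕ → X)
    (E : Type*) [MetricSpace E] : Coa e E → Coa e E → Prop :=
  fun p q => QuadLT p.1 q.1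

end EmbRank

end

namespace EmbRank

/-! Each quadruple is compressed to a countable code: the finite set `A`, and for each `k < A.card`
a natural-number upper bound for `ω` at scale `k + 1`, a scale beyond which `κ` is at least `k`, and
the approximate position in `E` of `φ` at one rational vector to one precision. Extending a
quadruple extends its code, so if the induced relation `R` on codes is well-founded, ranks are
bounded by those of a relation on a countable set, hence below `ω₁`.

Otherwise `R` has an infinite descending chain. Quadruples realizing its codes need not extend one
another, and their moduli may vary, but the recorded bounds stabilize and the maps converge
pointwise in the complete space `E`. The limit is a coarse embedding of the rational span of a
subsequence `(e_{m n})` (`coarselyEmbeds_of_cauchySeq`); subsymmetry and density carry it to `X`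
(`coarselyEmbeds_of_subsequence`). -/

theorem iSup_succ_lt_omega_one {ι : Type} [Countable ι] {f : ι → Ordinal.{0}}
    (hf : ∀ i, f i < Ordinal.omega 1) : ⨆ i, Order.succ (f i) < Ordinal.omega 1 := by
  refine Ordinal.iSup_lt_of_lt_cof ?_ fun i => (Cardinal.isSuccLimit_omega 1).succ_lt (hf i)
  rw [Cardinal.cof_omega_one]
  exact Cardinal.mk_le_aleph0.trans_lt Cardinal.aleph0_lt_aleph_one

theorem rank_lt_omega_one_of_countable {W : Type} [Countable W] {R : W → W → Prop}
    (hR : WellFounded R) (w : W) : (hR.apply w).rank < Ordinal.omega 1 := by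
  induction w using hR.induction with
  | _ w ih =>
    rw [Acc.rank_eq]
    exact iSup_succ_lt_omega_one fun b => ih b.1 b.2

/-- A relation-preserving map does not lower ranks. The lift is needed because quadruples may live
in a higher universe than their codes. -/
theorem hasCountableRank_of_countable.{u} {S : Type u} {r : S → S → Prop} {W : Type} [Countable W]
    {R : W → W → Prop} (hR : WellFounded R) (f : S → W) (hf : ∀ a b, r a b → R (f a) (f b)) :
    HasCountableRank r := by
  have h : WellFounded r := (InvImage.wf f hR).mono hf
  have key (a : S) : (h.apply a).rank ≤ Ordinal.lift.{u} (hR.apply (f a)).rank := by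
    induction a using h.induction with
    | _ a ih =>
      rw [Acc.rank_eq]
      refine Ordinal.iSup_le fun b => Order.succ_le_of_lt ((ih b.1 b.2).trans_lt ?_)
      exact Ordinal.lift_lt.2 (Acc.rank_lt_of_rel (hR.apply (f a)) (hf _ _ b.2))
  refine ⟨h, lt_of_le_of_lt (b := Ordinal.lift.{u} (⨆ w : W, Order.succ (hR.apply w).rank)) ?_ ?_⟩
  · refine Ordinal.iSup_le fun a => Order.succ_le_of_lt ((key a).trans_lt (Ordinal.lift_lt.2 ?_))
    exact Order.succ_le_iff.1
      (Ordinal.le_iSup (fun w => Order.succ (hR.apply w).rank) (f a))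
  · have := iSup_succ_lt_omega_one (rank_lt_omega_one_of_countable hR)
    rw [← Ordinal.lift_lt.{u}] at this
    simpa using this

/-! ### Rational combinations of basis vectors and passage to subsequences -/

variable {X : Type*} [NormedAddCommGroup X] [NormedSpace ℝ X]

theorem realize_eq_linearCombination (e : ℕ → X) (x : ℕ →₀ ℚ) :
    realize e x = Finsupp.linearCombination ℝ e (x.mapRange ((↑) : ℚ → ℝ) Rat.cast_zero) := by
  rw [Finsupp.linearCombination_apply, Finsupp.sum_mapRange_index (by simp)]
  rfl

theorem realize_sub (e : ℕ → X) (x y : ℕ →₀ ℚ) :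
    realize e (x - y) = realize e x - realize e y :=
  Finsupp.sum_sub_index fun n a b => by push_cast; exact sub_smul _ _ _

theorem realize_mapDomain (e : ℕ → X) {m : ℕ → ℕ} (x : ℕ →₀ ℚ) :
    realize e (x.mapDomain m) = realize (e ∘ m) x :=
  Finsupp.sum_mapDomain_index (by simp) fun n a b => by push_cast; exact add_smul _ _ _

theorem realize_injective {e : ℕ → X} (he : LinearIndependent ℝ e) :
    Function.Injective (realize e) := fun x y h => by
  rw [realize_eq_linearCombination, realize_eq_linearCombination] at h
  exact Finsupp.mapRange_injective _ Rat.cast_zero Rat.cast_injective (he h)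

theorem exists_norm_sub_realize_le_one (e : SchauderBasis ℝ X) (x : X) :
    ∃ y : ℕ →₀ ℚ, ‖x - realize e.basis y‖ ≤ 1 := by
  suffices h : x ∈ closure (Set.range (realize e.basis)) by
    obtain ⟨_, ⟨y, rfl⟩, hy⟩ := Metric.mem_closure_iff.1 h 1 one_pos
    exact ⟨y, by rw [← dist_eq_norm]; exact hy.le⟩
  have hadd (a b : ℕ →₀ ℚ) : realize e.basis (a + b) = realize e.basis a + realize e.basis b :=
    Finsupp.sum_add_index' (by simp) fun n a b => by push_cast; exact add_smul _ _ _
  let S : AddSubmonoid X := AddMonoidHom.mrange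
    ({ toFun := realize e.basis, map_zero' := Finsupp.sum_zero_index, map_add' := hadd } :
      (ℕ →₀ ℚ) →+ X)
  have hS : (S : Set X) = Set.range (realize e.basis) := rfl
  -- The closure is additively closed, so real multiples of single basis vectors suffice to reach
  -- every partial sum.
  have hmem (t : ℝ) (n : ℕ) : t • e.basis n ∈ S.topologicalClosure := by
    have h1 : t ∈ closure (Set.range ((↑) : ℚ → ℝ)) := Rat.denseRange_cast t
    refine map_mem_closure (f := fun t : ℝ => t • e.basis n) (by fun_prop) h1 ?_
    rintro _ ⟨q, rfl⟩
    exact ⟨Finsupp.single n q, Finsupp.sum_single_index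
      (h := fun n (q : ℚ) => (q : ℝ) • e.basis n) (by simp)⟩
  rw [← hS]
  refine S.isClosed_topologicalClosure.mem_of_tendsto (e.tendsto_proj x) (Eventually.of_forall ?_)
  intro n
  change GeneralSchauderBasis.proj e _ x ∈ _
  rw [GeneralSchauderBasis.proj_apply]
  exact sum_mem fun i _ => hmem _ _

theorem coarselyEmbeds_of_bounds {X E : Type*} [MetricSpace X] [MetricSpace E] {φ : X → E}
    (hω : ∀ r : ℝ, ∃ B : ℝ≥0∞, B < ∞ ∧ ∀ x y, dist x y ≤ r → edist (φ x) (φ y) ≤ B)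
    (hκ : ∀ M : ℕ, ∃ r : ℝ, ∀ x y, r ≤ dist x y → (M : ℝ≥0∞) ≤ edist (φ x) (φ y)) :
    CoarselyEmbeds X E := by
  refine ⟨φ, fun r => ?_, ?_⟩
  · obtain ⟨B, hB, h⟩ := hω r
    exact lt_of_le_of_lt (iSup_le fun x => iSup_le fun y => iSup_le (h x y)) hB
  · rw [ENNReal.tendsto_nhds_top_iff_nat]
    intro M
    obtain ⟨r, hr⟩ := hκ (M + 1)
    filter_upwards [eventually_ge_atTop ⌈r⌉₊] with n hn
    refine lt_of_lt_of_le (b := ((M + 1 : ℕ) : ℝ≥0∞)) (by exact_mod_cast M.lt_succ_self) ?_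
    refine le_iInf fun x => le_iInf fun y => le_iInf fun h => hr x y (le_trans ?_ h)
    refine (Nat.le_ceil r).trans ?_
    simp only [Scale.ofNatSucc]
    exact_mod_cast hn.trans n.le_succ

/-- Replacing points of `X` by rational vectors within distance 1 changes distances by at most 2,
and passing to the subsequence changes them by a factor of at most `C`; coarse bounds survive both.
-/
theorem coarselyEmbeds_of_subsequence {E : Type*} [MetricSpace E] (e : SchauderBasis ℝ X)
    {m : ℕ → ℕ} (hm : EquivalentSeq e.basis (e.basis ∘ m)) {ψ : (ℕ →₀ ℚ) → E} {b g : ℕ → ℕ}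
    (hb : ∀ (k : ℕ) x y, 0 < ‖realize (e.basis ∘ m) x - realize (e.basis ∘ m) y‖ →
      ‖realize (e.basis ∘ m) x - realize (e.basis ∘ m) y‖ ≤ k + 1 → edist (ψ x) (ψ y) ≤ b k)
    (hg : ∀ (k : ℕ) x y, (g k : ℝ) + 1 ≤ ‖realize (e.basis ∘ m) x - realize (e.basis ∘ m) y‖ →
      (k : ℝ≥0∞) ≤ edist (ψ x) (ψ y)) :
    CoarselyEmbeds X E := by
  obtain ⟨C, hC, hequiv⟩ := hm
  have hle (x y : ℕ →₀ ℚ) : ‖realize e.basis x - realize e.basis y‖ ≤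
      C * ‖realize (e.basis ∘ m) x - realize (e.basis ∘ m) y‖ := by
    rw [← realize_sub, ← realize_sub, realize_eq_linearCombination,
      realize_eq_linearCombination]
    exact (hequiv _).1
  have hge (x y : ℕ →₀ ℚ) : ‖realize (e.basis ∘ m) x - realize (e.basis ∘ m) y‖ ≤
      C * ‖realize e.basis x - realize e.basis y‖ := by
    rw [← realize_sub, ← realize_sub, realize_eq_linearCombination,
      realize_eq_linearCombination]
    exact (hequiv _).2
  choose s hs using exists_norm_sub_realize_le_one e
  have hnear (x y : X) : |dist x y - ‖realize e.basis (s x) - realize e.basis (s y)‖| ≤ 2 := by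
    rw [dist_eq_norm]
    refine (abs_norm_sub_norm_le _ _).trans ?_
    rw [sub_sub_sub_comm]
    exact (norm_sub_le _ _).trans (by linarith [hs x, hs y])
  refine coarselyEmbeds_of_bounds (φ := fun x => ψ (s x)) (fun r => ?_) fun M => ?_
  · refine ⟨b ⌈C * (r + 2)⌉₊, ENNReal.natCast_lt_top _, fun x y hxy => ?_⟩
    -- `hb` covers only distinct vectors; equal approximants have equal images.
    rcases eq_or_ne (s x) (s y) with h | h
    · simp [h]
    have hpos : 0 < ‖realize e.basis (s x) - realize e.basis (s y)‖ :=
      norm_pos_iff.2 (sub_ne_zero.2 ((realize_injective e.linearIndependent).ne h))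
    refine hb _ _ _ (pos_of_mul_pos_right (hpos.trans_le (hle _ _)) hC.le) ?_
    refine (hge _ _).trans ?_
    have h1 := (abs_le.1 (hnear x y)).1
    have h2 : C * ‖realize e.basis (s x) - realize e.basis (s y)‖ ≤ C * (r + 2) :=
      mul_le_mul_of_nonneg_left (by linarith) hC.le
    linarith [Nat.le_ceil (C * (r + 2))]
  · refine ⟨C * (g M + 1) + 2, fun x y hxy => hg _ _ _ ?_⟩
    have h1 := (abs_le.1 (hnear x y)).2
    exact le_of_mul_le_mul_left (by linarith [hle (s x) (s y)]) hC

/-! ### Countable data and limits of chains -/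

theorem IsCoarsePair.exists_nat_bounds {κ ω : Modulus} (h : IsCoarsePair κ ω) :
    ∃ b g : ℕ → ℕ, ∀ k : ℕ, ω (Scale.ofNatSucc k) ≤ b k ∧
      (k : ℝ≥0∞) ≤ κ (Scale.ofNatSucc (g k)) := by
  have h1 (k : ℕ) : ∃ b : ℕ, ω (Scale.ofNatSucc k) ≤ b :=
    (ENNReal.exists_nat_gt (h.1 (Scale.ofNatSucc k)).ne).imp fun _ => le_of_lt
  have h2 (k : ℕ) : ∃ g : ℕ, (k : ℝ≥0∞) ≤ κ (Scale.ofNatSucc g) :=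
    ((ENNReal.tendsto_nhds_top_iff_nat.1 h.2 k).exists).imp fun _ => le_of_lt
  choose b hb using h1
  choose g hg using h2
  exact ⟨b, g, fun k => ⟨hb k, hg k⟩⟩

/-- In a separable metric space, points are determined up to `2 / (l + 1)` by a natural number. -/
theorem exists_approximation_codes (E : Type*) [MetricSpace E] [TopologicalSpace.SeparableSpace E] :
    ∃ j : E → ℕ → ℕ, ∀ (l : ℕ) (p q : E), j p l = j q l → dist p q < 2 / ((l : ℝ) + 1) := by
  rcases isEmpty_or_nonempty E with _ | _
  · exact ⟨fun _ _ => 0, fun _ p => isEmptyElim p⟩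
  have h (p : E) (l : ℕ) : ∃ i : ℕ, dist p (TopologicalSpace.denseSeq E i) < 1 / ((l : ℝ) + 1) :=
    (TopologicalSpace.denseRange_denseSeq E).exists_dist_lt p Nat.one_div_pos_of_nat
  choose j hj using h
  refine ⟨j, fun l p q hpq => ?_⟩
  have h1 := hj p l
  have h2 := hj q l
  rw [← hpq, dist_comm] at h2
  calc dist p q ≤ _ := dist_triangle _ _ _
    _ < _ := add_lt_add h1 h2
    _ = _ := by ring

/-- Only the bounds `b` and `g` have to be common to the stages: non-strict inequalities between
distances pass to the pointwise limit, whether or not the moduli converge. -/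
theorem coarselyEmbeds_of_cauchySeq {E : Type*} [MetricSpace E] [CompleteSpace E]
    (e : SchauderBasis ℝ X) (he : IsSubsymmetric e.basis) {κ ω : ℕ → Modulus} {A : ℕ → Finset ℕ}
    {φ : ℕ → (ℕ →₀ ℚ) → E} (hΘ : ∀ n, (κ n, ω n, A n, φ n) ∈ Theta e.basis E)
    (hA : ∀ n, StarPrec (A (n + 1)) (A n)) {b g : ℕ → ℕ}
    (hb : ∀ k, ∀ᶠ n in atTop, ω n (Scale.ofNatSucc k) ≤ b k)
    (hg : ∀ k : ℕ, ∀ᶠ n in atTop, (k : ℝ≥0∞) ≤ κ n (Scale.ofNatSucc (g k)))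
    (hφ : ∀ N, ∀ x ∈ Finsupp.supported ℚ ℚ (A N : Set ℕ), CauchySeq fun n => φ n x) :
    CoarselyEmbeds X E := by
  choose m hm hAm using hA
  have hmem (n : ℕ) : m n ∈ A (n + 1) := by rw [hAm]; exact Finset.mem_insert_self _ _
  have hmono : StrictMono m := strictMono_nat_of_lt_succ fun n => hm (n + 1) _ (hmem n)
  have hAmono : Monotone A := monotone_nat_of_le_succ fun n => by
    rw [hAm]; exact Finset.subset_insert _ _
  have hsupp (x : ℕ →₀ ℚ) :
      ∀ᶠ n in atTop, x.mapDomain m ∈ Finsupp.supported ℚ ℚ (A n : Set ℕ) := by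
    filter_upwards [eventually_ge_atTop (x.support.sup id + 1)] with n hn
    rw [Finsupp.mem_supported]
    refine (Finset.coe_subset.2 Finsupp.mapDomain_support).trans fun i hi => ?_
    obtain ⟨k, hk, rfl⟩ := Finset.mem_image.1 (Finset.mem_coe.1 hi)
    exact hAmono ((Nat.succ_le_succ (Finset.le_sup (f := id) hk)).trans hn) (hmem k)
  have hlim (x : ℕ →₀ ℚ) : ∃ p, Tendsto (fun n => φ n (x.mapDomain m)) atTop (𝓝 p) := by
    obtain ⟨N, hN⟩ := (hsupp x).exists
    exact cauchySeq_tendsto_of_complete (hφ N _ hN)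
  choose ψ hψ using hlim
  refine coarselyEmbeds_of_subsequence e (he m hmono) (ψ := ψ) (b := b) (g := g) ?_ ?_
  · intro k x y hpos hle
    refine le_of_tendsto ((hψ x).edist (hψ y)) ?_
    filter_upwards [hb k, hsupp x, hsupp y] with n hn hx hy
    rw [← realize_mapDomain, ← realize_mapDomain] at hpos hle
    refine ((hΘ n _ hx _ hy hpos).2.trans ((ω n).monotone ?_)).trans hn
    exact (isLeast_upperScale hpos).2 (by simpa [Scale.ofNatSucc] using hle)
  · intro k x y hle
    refine ge_of_tendsto ((hψ x).edist (hψ y)) ?_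
    filter_upwards [hg k, hsupp x, hsupp y] with n hn hx hy
    rw [← realize_mapDomain, ← realize_mapDomain] at hle
    have hpos : 0 < ‖realize e.basis (x.mapDomain m) - realize e.basis (y.mapDomain m)‖ :=
      lt_of_lt_of_le (by positivity) hle
    refine (hn.trans ((κ n).monotone ?_)).trans (hΘ n _ hx _ hy hpos).1
    exact (isGreatest_lowerScale hpos).2 (by simpa [Scale.ofNatSucc] using hle)

theorem StarPrec.card_lt {A B : Finset ℕ} (h : StarPrec A B) : B.card < A.card := by
  obtain ⟨m, hm, rfl⟩ := h
  rw [Finset.card_insert_of_notMem fun h => (hm m h).false]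
  exact Nat.lt_succ_self _

theorem StarPrec.subset {A B : Finset ℕ} (h : StarPrec A B) : B ⊆ A := by
  obtain ⟨m, -, rfl⟩ := h
  exact Finset.subset_insert _ _

theorem eq_of_forall_ge_succ_eq {α : Type*} {f : ℕ → α} {N : ℕ} (h : ∀ n, N ≤ n → f (n + 1) = f n)
    {n : ℕ} (hn : N ≤ n) : f n = f N := by
  induction n, hn using Nat.le_induction with
  | base => rfl
  | succ n hn ih => rw [h n hn, ih]

end EmbRank

theorem mainTheorem6 {X : Type*} [NormedAddCommGroup X] [NormedSpace ℝ X] [CompleteSpace X]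
    {E : Type*} [MetricSpace E] [CompleteSpace E] [TopologicalSpace.SeparableSpace E]
    (e : SchauderBasis ℝ X) (he : EmbRank.IsSubsymmetric e.basis) :
    EmbRank.CoarselyEmbeds X E ∨ EmbRank.HasCountableRank (EmbRank.CoaLT e.basis E) := by
  open EmbRank in
  obtain ⟨j, hj⟩ := exists_approximation_codes E
  obtain ⟨v, hv⟩ := exists_surjective_nat (ℕ →₀ ℚ)
  choose b g hbg using fun (κ ω : Modulus) (h : IsCoarsePair κ ω) => h.exists_nat_bounds
  let c (q : Coa e.basis E) (k : ℕ) : ℕ × ℕ × ℕ :=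
    (b q.1.1 q.1.2.1 q.2.2 k, g q.1.1 q.1.2.1 q.2.2 k, j (q.1.2.2.2 (v k.unpair.1)) k.unpair.2)
  -- Truncating at `A.card` keeps the set of codes countable; as `A` grows along a chain, every
  -- coordinate is eventually recorded.
  let f (q : Coa e.basis E) : Σ A : Finset ℕ, (Fin A.card → ℕ × ℕ × ℕ) :=
    ⟨q.1.2.2.1, fun k => c q k⟩
  -- Position codes are compared only at vectors of the smaller span, the only place where `<` makes
  -- the maps agree.
  let R (w' w : Σ A : Finset ℕ, (Fin A.card → ℕ × ℕ × ℕ)) : Prop :=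
    w' ∈ Set.range f ∧ StarPrec w'.1 w.1 ∧ ∀ k (h' : k < w'.1.card) (h : k < w.1.card),
      (w'.2 ⟨k, h'⟩).1 = (w.2 ⟨k, h⟩).1 ∧ (w'.2 ⟨k, h'⟩).2.1 = (w.2 ⟨k, h⟩).2.1 ∧
      (v k.unpair.1 ∈ Finsupp.supported ℚ ℚ (w.1 : Set ℕ) →
        (w'.2 ⟨k, h'⟩).2.2 = (w.2 ⟨k, h⟩).2.2)
  by_cases hR : WellFounded R
  · right
    refine hasCountableRank_of_countable hR f ?_
    rintro ⟨⟨κ', ω', A', φ'⟩, hq'⟩ ⟨⟨κ, ω, A, φ⟩, hq⟩ ⟨⟨rfl, rfl⟩, hA, hφ⟩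
    refine ⟨⟨_, rfl⟩, hA, fun k _ _ => ⟨rfl, rfl, fun hk => ?_⟩⟩
    exact congrArg (fun p => j p _) (hφ hk)
  · left
    rw [wellFounded_iff_isEmpty_descending_chain, not_isEmpty_iff] at hR
    obtain ⟨w, hw⟩ := hR
    -- `R` puts only its smaller argument in the range of `f`, so `q n` realizes the chain's term `n
    -- + 1`.
    choose q hq using fun n => (hw n).1
    have hRq (n : ℕ) : R (f (q (n + 1))) (f (q n)) := by
      rw [hq, hq]; exact hw _
    have hA (n : ℕ) : StarPrec (q (n + 1)).1.2.2.1 (q n).1.2.2.1 := (hRq n).2.1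
    have hcard (n : ℕ) : n ≤ (q n).1.2.2.1.card :=
      (strictMono_nat_of_lt_succ fun n => (hA n).card_lt).le_apply
    have hAmono : Monotone fun n => (q n).1.2.2.1 := monotone_nat_of_le_succ fun n => (hA n).subset
    have hc (k n : ℕ) (hn : k + 1 ≤ n) := (hRq n).2.2 k
      ((Nat.lt_of_succ_le hn).trans_le (n.le_succ.trans (hcard _)))
      ((Nat.lt_of_succ_le hn).trans_le (hcard n))
    refine coarselyEmbeds_of_cauchySeq e he (κ := fun n => (q n).1.1) (ω := fun n => (q n).1.2.1)
      (A := fun n => (q n).1.2.2.1) (φ := fun n => (q n).1.2.2.2) (fun n => (q n).2.1) hA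
      (b := fun k => (c (q (k + 1)) k).1) (g := fun k => (c (q (k + 1)) k).2.1) ?_ ?_ ?_
    · intro k
      filter_upwards [eventually_ge_atTop (k + 1)] with n hn
      rw [← eq_of_forall_ge_succ_eq (f := fun n => (c (q n) k).1) (fun n hn => (hc k n hn).1) hn]
      exact (hbg _ _ _ k).1
    · intro k
      filter_upwards [eventually_ge_atTop (k + 1)] with n hn
      rw [← eq_of_forall_ge_succ_eq (f := fun n => (c (q n) k).2.1)
        (fun n hn => (hc k n hn).2.1) hn]
      exact (hbg _ _ _ k).2
    · intro N x hx
      obtain ⟨i, rfl⟩ := hv x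
      refine Metric.cauchySeq_iff'.2 fun ε hε => ?_
      obtain ⟨l, hl⟩ := exists_nat_one_div_lt (half_pos hε)
      -- From this stage on `v i` lies in the span and coordinate `Nat.pair i l` is recorded, so the
      -- code of its image at precision `l` is constant.
      refine ⟨max N (Nat.pair i l + 1), fun n hn => (hj l _ _ ?_).trans ?_⟩
      · refine eq_of_forall_ge_succ_eq (f := fun n => j ((q n).1.2.2.2 (v i)) l) (fun n hn => ?_) hn
        have h := (hc (Nat.pair i l) n ((le_max_right _ _).trans hn)).2.2
        simp only [f, c, Nat.unpair_pair] at h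
        exact h (Finsupp.supported_mono
          (Finset.coe_subset.2 (hAmono ((le_max_left _ _).trans hn))) hx)
      · calc 2 / ((l : ℝ) + 1) = 2 * (1 / ((l : ℝ) + 1)) := by ring
          _ < ε := by linarith
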